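/- Let $(\mathbb X,\mathcal X)$ be a standard Borel space. On any measurable space $(E,\mathcal E)$, a sequence $(X_n)_{n\ge1}$ of $E$-valued random variables is an MVPS$(\theta,\nu,R)$ (measure-valued Pólya sequence), where $\theta>0$, $\nu$ is a probability measure on $E$ and $R=(R_x)_{x\in E}$ is a finite transition kernel on $E$, if $X_1\sim\nu$ and, for all $n\ge1$ and $A\in\mathcal E$, $$\mathbb P(X_{n+1}\in A\mid X_1,\dots,X_n)=\frac{\theta\nu(A)+\sum_{i=1}^nR_{X_i}(A)}{\theta+\sum_{i=1}^nR_{X_i}(E)}\quad\text{a.s.}$$ It is exchangeable if $(X_1,\dots,X_n)$ and $(X_{\sigma(1)},\dots,X_{\sigma(n)})$ have the same law for every $n$ and every permutation $\sigma$ of $\{1,\dots,n\}$. Let $(X_n)_{n\ge1}$ be an exchangeable MVPS$(\theta,\nu,R)$ on $\mathbb X$, put $Z:=\{x\in\mathbb X:R_x(\mathbb X)=0\}$, and suppose that $R_x(\mathbb X)=1$ for all $x\in Z^c$ (the canonical parametrization) and $0<\nu(Z)<1$. Then there exists a sub-$\sigma$-algebra $\mathcal G\subseteq\mathcal X$ such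 that (a) $\mathcal G$ is countably generated under $\nu$, i.e. there is $C\in\mathcal G$ with $\nu(C)=1$ for which $\mathcal G\cap C$ is countably generated; (b) $Z^c\in\mathcal G$, and for $\nu$-almost every $x\in Z^c$ $$\frac{R_x(\cdot)}{R_x(\mathbb X)}=\nu(Z^c)\,\nu(\cdot\mid\mathcal G)(x)+\nu(Z)\,\nu(\cdot\mid Z),$$ where $\nu(\cdot\mid\mathcal G)$ is a regular conditional distribution of $\nu$ given $\mathcal G$. Moreover, for every sub-$\sigma$-algebra $\mathcal G\subseteq\mathcal X$ satisfying (a) and (b) the following holds. Let $\pi(x)=[x]_{\mathcal G}:=\bigcap_{G\in\mathcal G,\,x\in G}G$ be the $\mathcal G$-atom of $x$, let $\Pi=\pi(\mathbb X)$ be the set of $\mathcal G$-atoms, equipped with the $\sigma$-algebra $\{P\subseteq\Pi:\pi^{-1}(P)\in\mathcal G\}$, and let $\nu_\pi=\nu\circ\pi^{-1}$. Then $(\pi(X_n))_{n\ge1}$ is an exchangeable MVPS$(\theta,\nu_\pi,R_\pi)$ on $\Pi$, where $$(R_\pi)_p(\cdot)=\begin{cases}\nu(Z^c)\,\delta_p(\cdot)+\nu(Z)\,\nu_\pi(\cdot\mid\pi(Z))&\text{if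 }p\in\pi(Z^c),\\0&\text{if }p\in\pi(Z).\end{cases}$$ -/

import Mathlib

open MeasureTheory ProbabilityTheory

/-- A sequence of random variables is exchangeable if the joint law of each initial segment is
invariant under permutations. Indices start at `0`: `X 0` is the first variable. -/
def Exchangeable {Ω E : Type*} {mΩ : MeasurableSpace Ω} [mE : MeasurableSpace E]
    (μ : Measure Ω) (X : ℕ → Ω → E) : Prop :=
  ∀ (n : ℕ) (σ : Equiv.Perm (Fin n)),
    IdentDistrib (fun ω (i : Fin n) => X i ω) (fun ω (i : Fin n) => X (σ i) ω) μ μ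

/-- The σ-algebra generated by the first `n` variables `X 0, …, X (n - 1)`. -/
abbrev pastSigma {Ω E : Type*} [mE : MeasurableSpace E] (X : ℕ → Ω → E) (n : ℕ) : MeasurableSpace Ω :=
  MeasurableSpace.comap (fun ω (i : Fin n) => X i ω) MeasurableSpace.pi

/-- `X` is a measure-valued Pólya sequence with parameters `θ`, `ν` and reinforcement kernel `R`.
The space `E` is an arbitrary measurable space. `Measurable R` and `finite_reinf` say that `R` is a
finite transition kernel; `predictive` says that the normalized urn content is a (regular) version
of the conditional distribution of `X n` given the first `n` variables. -/
structure IsMVPS {Ω E : Type*} {mΩ : MeasurableSpace Ω} {mE : MeasurableSpace E} (μ : Measure Ω)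
    (θ : ℝ) (ν : Measure E) (R : E → Measure E) (X : ℕ → Ω → E) : Prop where
  measurable_seq : ∀ n, Measurable (X n)
  theta_pos : 0 < θ
  isProbabilityMeasure : IsProbabilityMeasure ν
  measurable_reinf : Measurable R
  finite_reinf : ∀ x, IsFiniteMeasure (R x)
  law_first : μ.map (X 0) = ν
  predictive : ∀ n, 1 ≤ n → ∀ A : Set E, MeasurableSet A →
    μ⟦X n ⁻¹' A | pastSigma X n⟧ =ᵐ[μ] fun ω =>
      (θ * ν.real A + ∑ i : Fin n, (R (X i ω)).real A) /
        (θ + ∑ i : Fin n, (R (X i ω)).real Set.univ)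

/-- The set `Z` of points with zero reinforcement. -/
def nullPart {E : Type*} {mE : MeasurableSpace E} (R : E → Measure E) : Set E :=
  {x | R x Set.univ = 0}

/-- The parametrization is canonical: the reinforcement has total mass `1` at every point
outside the null part. -/
def IsCanonical {E : Type*} {mE : MeasurableSpace E} (R : E → Measure E) : Prop :=
  ∀ x ∈ (nullPart R)ᶜ, R x Set.univ = 1

/-- The sub-σ-algebra `G` is countably generated under `ν`: there is `C ∈ G` with `ν C = 1` whose
trace σ-algebra `G ∩ C` is countably generated. -/
def CountablyGeneratedUnder {E : Type*} (G : MeasurableSpace E) {mE : MeasurableSpace E}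
    (ν : Measure E) : Prop :=
  ∃ C : Set E, MeasurableSet[G] C ∧ ν C = 1 ∧
    @MeasurableSpace.CountablyGenerated C (MeasurableSpace.comap ((↑) : C → E) G)

/-- `G` is a conditioning σ-algebra of the reinforcement kernel `R` with null part `Z`: a
sub-σ-algebra, countably generated under `ν`, which contains `Zᶜ` and satisfies
`R_x / R_x(E) = ν(Zᶜ) ν(· ∣ G)(x) + ν(Z) ν(· ∣ Z)` for `ν`-almost every `x ∈ Zᶜ`.
Here `condExpKernel ν G` is the regular conditional distribution of `ν` given `G`. -/
structure IsConditioningSigma {E : Type*} (G : MeasurableSpace E) {mE : MeasurableSpace E}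
    [StandardBorelSpace E] (ν : Measure E) [IsFiniteMeasure ν] (R : E → Measure E) : Prop where
  le : G ≤ mE
  countablyGenerated : CountablyGeneratedUnder G ν
  measurableSet_compl : MeasurableSet[G] (nullPart R)ᶜ
  representation : ∀ᵐ x ∂ν, x ∈ (nullPart R)ᶜ →
    (R x Set.univ)⁻¹ • R x =
      ν (nullPart R)ᶜ • condExpKernel ν G x + ν (nullPart R) • ν[|nullPart R]

/-- The set `Π` of the atoms `[x]_G` of the σ-algebra `G`. -/
def AtomSpace {E : Type*} (G : MeasurableSpace E) : Type _ :=
  Set.range (fun x : E => @measurableAtom E G x)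

/-- The atom map `π`, which sends a point to its `G`-atom. -/
def atomMap {E : Type*} (G : MeasurableSpace E) : E → AtomSpace G :=
  fun x => ⟨@measurableAtom E G x, x, rfl⟩

/-- The σ-algebra on `Π` of all `P` with `π ⁻¹(P) ∈ G`. -/
instance AtomSpace.instMeasurableSpace {E : Type*} (G : MeasurableSpace E) :
    MeasurableSpace (AtomSpace G) :=
  MeasurableSpace.map (atomMap G) G

/-- The image measure `ν_π = ν ∘ π⁻¹` on the space of atoms. -/
noncomputable def atomLaw {E : Type*} (G : MeasurableSpace E) {mE : MeasurableSpace E}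
    (ν : Measure E) : Measure (AtomSpace G) :=
  ν.map (atomMap G)

open Classical in
/-- The reinforcement `R_π` on the space of atoms, for the base measure `ν` and the null part `Z`:
`ν(Zᶜ) δ_p + ν(Z) ν_π(· ∣ π(Z))` for `p ∈ π(Zᶜ)`, and `0` otherwise. -/
noncomputable def atomReinforcement {E : Type*} (G : MeasurableSpace E) {mE : MeasurableSpace E}
    (ν : Measure E) (Z : Set E) (p : AtomSpace G) :
    Measure (AtomSpace G) :=
  if p ∈ atomMap G '' Zᶜ then
    ν Zᶜ • Measure.dirac p + ν Z • (atomLaw G ν)[|atomMap G '' Z]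
  else 0

/-! Write q = ν(Zᶜ). The conditioning σ-algebra is σ(R), generated by x ↦ R_x. Swapping the first
two draws shows that R is reversible for ν on Zᶜ (`setLIntegral_reinf_comm`) and that R_x agrees
with ν inside Z for almost every x ∈ Zᶜ (`reinf_ae_eq_of_subset_nullPart`). Hence R_x(Zᶜ) = q, and
R/q restricted to Zᶜ is a Markov kernel preserving ν.

Swapping the second and third draws makes this kernel idempotent: ∫_{Zᶜ} R_y(C) R_x(dy) = q R_x(C).
A variance computation then gives ∫∫ (R_y(C) - R_x(C))² R_x(dy) ν(dx) = 0 over Zᶜ, so R_y = R_x for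
R_x-almost every y ∈ Zᶜ (`reinf_ae_ae_eq`). Thus R_x(B ∩ Zᶜ) = q 1_B(x) for B ∈ σ(R), and
reversibility identifies R_x on Zᶜ with q ν(· ∣ σ(R))(x).

For the atoms, let G be any conditioning σ-algebra. On sets of G the kernel ν(· ∣ G)(x) is a point
mass at x, so the representation pushes forward to R_π almost everywhere (`reinf_preimage_ae_eq`).
Every draw has law ν, so the exceptional null sets are harmless, and the tower property passes to
the coarser past (`IsMVPS.map`). -/

/-! ### The space of atoms and its reinforcement -/

section AtomSpace

variable {E : Type*} {G mE : MeasurableSpace E}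

theorem measurable_atomMap (hG : G ≤ mE) : Measurable[mE] (atomMap G) :=
  fun _ hP => hG _ hP

/-- A set of G is a union of G-atoms, hence saturated for the atom map. -/
theorem atomMap_preimage_image {s : Set E} (hs : MeasurableSet[G] s) :
    atomMap G ⁻¹' (atomMap G '' s) = s := by
  refine subset_antisymm ?_ (Set.subset_preimage_image _ _)
  rintro x ⟨y, hy, hyx⟩
  have h : @measurableAtom E G y = @measurableAtom E G x := congrArg Subtype.val hyx
  have hx : x ∈ @measurableAtom E G y := h ▸ @mem_measurableAtom_self E G x
  exact (letI := G; measurableAtom_subset hs hy) hx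

theorem measurableSet_atomMap_image {s : Set E} (hs : MeasurableSet[G] s) :
    MeasurableSet (atomMap G '' s) := by
  change MeasurableSet[G] (atomMap G ⁻¹' (atomMap G '' s))
  rwa [atomMap_preimage_image hs]

theorem atomLaw_apply (hG : G ≤ mE) (ν : Measure E) {P : Set (AtomSpace G)}
    (hP : MeasurableSet P) : atomLaw G ν P = ν (atomMap G ⁻¹' P) :=
  Measure.map_apply (measurable_atomMap hG) hP

theorem atomReinforcement_atomMap_apply (hG : G ≤ mE) (ν : Measure E) {Z : Set E}
    (hZ : MeasurableSet[G] Z) {P : Set (AtomSpace G)} (hP : MeasurableSet P) {x : E}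
    (hx : x ∈ Zᶜ) :
    atomReinforcement G ν Z (atomMap G x) P =
      ν Zᶜ * (atomMap G ⁻¹' P).indicator 1 x + ν Z * ν[atomMap G ⁻¹' P | Z] := by
  have hZE : MeasurableSet[mE] Z := hG _ hZ
  rw [atomReinforcement, if_pos ⟨x, hx, rfl⟩]
  simp only [Measure.add_apply, Measure.smul_apply, smul_eq_mul, Measure.dirac_apply' _ hP]
  rw [cond_apply (measurableSet_atomMap_image hZ), cond_apply hZE, atomLaw_apply hG ν
    (measurableSet_atomMap_image hZ), atomLaw_apply hG ν ((measurableSet_atomMap_image hZ).inter hP),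
    Set.preimage_inter, atomMap_preimage_image hZ]
  rfl

theorem atomReinforcement_atomMap_of_mem (ν : Measure E) {Z : Set E}
    (hZ : MeasurableSet[G] Z) {x : E} (hx : x ∈ Z) :
    atomReinforcement G ν Z (atomMap G x) = 0 := by
  rw [atomReinforcement, if_neg]
  intro h
  have : x ∈ atomMap G ⁻¹' (atomMap G '' Zᶜ) := h
  rw [atomMap_preimage_image hZ.compl] at this
  exact this hx

theorem measurable_atomReinforcement (ν : Measure E) {Z : Set E} (hZ : MeasurableSet[G] Z) :
    Measurable (atomReinforcement G ν Z) := by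
  classical
  refine Measurable.ite (measurableSet_atomMap_image hZ.compl) ?_ measurable_const
  refine Measure.measurable_of_measurable_coe _ fun s hs => ?_
  simp only [Measure.add_apply, Measure.smul_apply, smul_eq_mul]
  exact ((Measure.measurable_coe hs |>.comp Measure.measurable_dirac).const_mul _).add_const _

theorem isFiniteMeasure_atomReinforcement (ν : Measure E) [IsFiniteMeasure ν] (Z : Set E)
    (p : AtomSpace G) : IsFiniteMeasure (atomReinforcement G ν Z p) := by
  rw [atomReinforcement]
  split_ifs
  · have h (a : ENNReal) (ha : a ≠ ⊤) (m : Measure (AtomSpace G)) [IsFiniteMeasure m] :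
        IsFiniteMeasure (a • m) := m.smul_finite ha
    have := h _ (measure_ne_top ν Zᶜ) (Measure.dirac p)
    have := h _ (measure_ne_top ν Z) ((atomLaw G ν)[|atomMap G '' Z])
    infer_instance
  · infer_instance

end AtomSpace

/-! ### Passage to the atoms -/

theorem condExpKernel_apply_ae_eq_indicator {E : Type*} {G mE : MeasurableSpace E}
    [StandardBorelSpace E] (hG : G ≤ mE) (ν : Measure E) [IsFiniteMeasure ν] {s : Set E}
    (hs : MeasurableSet[G] s) :
    ∀ᵐ x ∂ν, condExpKernel ν G x s = s.indicator 1 x := by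
  have h := condExpKernel_ae_eq_condExp (μ := ν) hG (hG _ hs)
  rw [condExp_of_stronglyMeasurable hG (stronglyMeasurable_const.indicator hs)
    ((integrable_const _).indicator (hG _ hs))] at h
  filter_upwards [h] with x hx
  by_cases hxs : x ∈ s <;>
    simp only [hxs, Set.indicator_of_mem, Set.indicator_of_notMem, not_false_eq_true,
      Pi.one_apply] at hx ⊢
  · rw [← ENNReal.toReal_eq_one_iff]; exact hx
  · rwa [measureReal_eq_zero_iff] at hx

namespace IsConditioningSigma

variable {E : Type*} {G mE : MeasurableSpace E} [StandardBorelSpace E] {ν : Measure E}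
  [IsFiniteMeasure ν] {R : E → Measure E}

theorem reinf_preimage_ae_eq (h : IsConditioningSigma G ν R) (hcan : IsCanonical R)
    {P : Set (AtomSpace G)} (hP : MeasurableSet P) :
    ∀ᵐ x ∂ν, R x (atomMap G ⁻¹' P) =
      atomReinforcement G ν (nullPart R) (atomMap G x) P := by
  have hZ : MeasurableSet[G] (nullPart R) := by simpa using h.measurableSet_compl.compl
  filter_upwards [h.representation,
    condExpKernel_apply_ae_eq_indicator h.le ν (s := atomMap G ⁻¹' P) hP] with x hx hxP
  by_cases hxZ : x ∈ nullPart R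
  · rw [atomReinforcement_atomMap_of_mem ν hZ hxZ, Measure.measure_univ_eq_zero.1 hxZ]
    rfl
  · rw [atomReinforcement_atomMap_apply h.le ν hZ hP hxZ, ← hxP]
    have := hx hxZ
    rw [hcan x hxZ, inv_one, one_smul] at this
    conv_lhs => rw [this]
    rfl

end IsConditioningSigma

theorem Exchangeable.map_eq {Ω E : Type*} {mΩ : MeasurableSpace Ω} [MeasurableSpace E]
    {μ : Measure Ω} {X : ℕ → Ω → E} (hX : Exchangeable μ X) (n : ℕ) :
    μ.map (X n) = μ.map (X 0) := by
  have h := (hX (n + 1) (Equiv.swap 0 (Fin.last n))).comp (measurable_pi_apply 0)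
  have := h.map_eq
  simp only [Function.comp_def, Equiv.swap_apply_left] at this
  exact this.symm

theorem Exchangeable.comp {Ω E F : Type*} {mΩ : MeasurableSpace Ω} {mE : MeasurableSpace E}
    {mF : MeasurableSpace F} {μ : Measure Ω} {X : ℕ → Ω → E} (hX : Exchangeable μ X) {f : E → F}
    (hf : Measurable f) : Exchangeable μ (fun n ω => f (X n ω)) := fun n σ =>
  (hX n σ).comp (u := fun x i => f (x i)) (by fun_prop)

/-- The image of an exchangeable measure-valued Pólya sequence under a measurable map which
intertwines the reinforcement kernels almost everywhere. -/
theorem IsMVPS.map {Ω E F : Type*} {mΩ : MeasurableSpace Ω} {mE : MeasurableSpace E}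
    {mF : MeasurableSpace F} {μ : Measure Ω} [IsFiniteMeasure μ] {θ : ℝ} {ν : Measure E}
    {R : E → Measure E} {X : ℕ → Ω → E} (hX : IsMVPS μ θ ν R X) (hexch : Exchangeable μ X)
    {f : E → F} (hf : Measurable f) {S : F → Measure F} (hS : Measurable S)
    (hSfin : ∀ y, IsFiniteMeasure (S y))
    (hRS : ∀ P : Set F, MeasurableSet P → ∀ᵐ x ∂ν, R x (f ⁻¹' P) = S (f x) P) :
    IsMVPS μ θ (ν.map f) S (fun n ω => f (X n ω)) where
  measurable_seq n := hf.comp (hX.measurable_seq n)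
  theta_pos := hX.theta_pos
  isProbabilityMeasure :=
    haveI := hX.isProbabilityMeasure
    Measure.isProbabilityMeasure_map hf.aemeasurable
  measurable_reinf := hS
  finite_reinf := hSfin
  law_first := by
    rw [← hX.law_first, Measure.map_map hf (hX.measurable_seq 0)]
    rfl
  predictive n hn P hP := by
    -- The intertwining holds only ν-almost everywhere; it can be evaluated at each past draw
    -- because exchangeability gives every draw the law ν.
    have hae (Q : Set F) (hQ : MeasurableSet Q) :
        ∀ᵐ ω ∂μ, ∀ i : Fin n, R (X i ω) (f ⁻¹' Q) = S (f (X i ω)) Q := by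
      refine ae_all_iff.2 fun i => ?_
      refine ae_of_ae_map (p := fun x => R x (f ⁻¹' Q) = S (f x) Q)
        (hX.measurable_seq i).aemeasurable ?_
      rw [hexch.map_eq, hX.law_first]
      exact hRS Q hQ
    set g : Ω → ℝ := fun ω => (θ * (ν.map f).real P + ∑ i : Fin n, (S (f (X i ω))).real P) /
        (θ + ∑ i : Fin n, (S (f (X i ω))).real Set.univ) with hg
    have hpast : Measurable (fun ω (i : Fin n) => X i ω) :=
      measurable_pi_lambda _ fun i => hX.measurable_seq i
    have hle : pastSigma (fun n ω => f (X n ω)) n ≤ pastSigma X n := by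
      rintro _ ⟨t, ht, rfl⟩
      exact ⟨(fun x i => f (x i)) ⁻¹' t,
        measurable_pi_lambda _ (fun i => hf.comp (measurable_pi_apply i)) ht, rfl⟩
    have hXg : μ⟦X n ⁻¹' (f ⁻¹' P) | pastSigma X n⟧ =ᵐ[μ] g := by
      filter_upwards [hX.predictive n hn _ (hf hP), hae P hP, hae Set.univ .univ] with ω h1 h2 h3
      rw [h1, hg]
      simp only [Set.preimage_univ] at h3
      simp only [Measure.real, h2, h3, Measure.map_apply hf hP]
    have hgm : StronglyMeasurable[pastSigma (fun n ω => f (X n ω)) n] g := by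
      refine Measurable.stronglyMeasurable ?_
      have : Measurable fun y : Fin n → F =>
          (θ * (ν.map f).real P + ∑ i : Fin n, (S (y i)).real P) /
            (θ + ∑ i : Fin n, (S (y i)).real Set.univ) := by
        have h (Q : Set F) (hQ : MeasurableSet Q) :
            Measurable fun y : Fin n → F => ∑ i : Fin n, (S (y i)).real Q :=
          Finset.measurable_sum _ fun i _ => (((Measure.measurable_coe hQ).comp
            hS).comp (measurable_pi_apply i)).ennreal_toReal
        exact ((h P hP).const_add _).div ((h _ .univ).const_add _)
      exact this.comp (comap_measurable _)
    -- Given the finer past of `X`, the predictive probability is already a function of the images,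
    -- so conditioning it again on their past changes nothing.
    have htower := condExp_condExp_of_le (μ := μ) (f := (X n ⁻¹' (f ⁻¹' P)).indicator fun _ => (1 : ℝ))
      hle hpast.comap_le
    refine htower.symm.trans ((condExp_congr_ae hXg).trans ?_)
    rw [condExp_of_stronglyMeasurable (hle.trans hpast.comap_le) hgm
      (integrable_condExp.congr hXg)]

theorem IsConditioningSigma.isMVPS_atomMap {Ω E : Type*} {mΩ : MeasurableSpace Ω}
    {G mE : MeasurableSpace E} [StandardBorelSpace E] {μ : Measure Ω} [IsFiniteMeasure μ] {θ : ℝ}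
    {ν : Measure E} [IsFiniteMeasure ν] {R : E → Measure E} {X : ℕ → Ω → E}
    (h : IsConditioningSigma G ν R) (hX : IsMVPS μ θ ν R X) (hexch : Exchangeable μ X)
    (hcan : IsCanonical R) :
    IsMVPS μ θ (atomLaw G ν) (atomReinforcement G ν (nullPart R))
      (fun n ω => atomMap G (X n ω)) :=
  hX.map hexch (measurable_atomMap h.le)
    (measurable_atomReinforcement ν (by simpa using h.measurableSet_compl.compl))
    (isFiniteMeasure_atomReinforcement ν _) fun _ hP => h.reinf_preimage_ae_eq hcan hP

/-! ### Symmetry of two and three draws -/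

section Exchangeable

variable {Ω E : Type*} {mΩ : MeasurableSpace Ω} [MeasurableSpace E] {μ : Measure Ω} {X : ℕ → Ω → E}

theorem Exchangeable.measure_inter_comm (hX : Exchangeable μ X) {A B : Set E}
    (hA : MeasurableSet A) (hB : MeasurableSet B) :
    μ (X 0 ⁻¹' A ∩ X 1 ⁻¹' B) = μ (X 0 ⁻¹' B ∩ X 1 ⁻¹' A) := by
  have hS : MeasurableSet {x : Fin 2 → E | x 0 ∈ A ∧ x 1 ∈ B} :=
    (measurable_pi_apply 0 hA).inter (measurable_pi_apply 1 hB)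
  have h := (hX 2 (Equiv.swap 0 1)).measure_mem_eq hS
  simp only [Set.preimage_ofPred_eq, Equiv.swap_apply_left, Equiv.swap_apply_right] at h
  rw [Set.inter_comm (X 0 ⁻¹' B)]
  exact h

theorem Exchangeable.measure_inter_inter_comm (hX : Exchangeable μ X) {A B C : Set E}
    (hA : MeasurableSet A) (hB : MeasurableSet B) (hC : MeasurableSet C) :
    μ (X 0 ⁻¹' A ∩ X 1 ⁻¹' B ∩ X 2 ⁻¹' C) = μ (X 0 ⁻¹' A ∩ X 1 ⁻¹' C ∩ X 2 ⁻¹' B) := by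
  have hS : MeasurableSet {x : Fin 3 → E | (x 0 ∈ A ∧ x 1 ∈ B) ∧ x 2 ∈ C} :=
    ((measurable_pi_apply 0 hA).inter (measurable_pi_apply 1 hB)).inter (measurable_pi_apply 2 hC)
  have h := (hX 3 (Equiv.swap 1 2)).measure_mem_eq hS
  have h0 : (Equiv.swap (1 : Fin 3) 2) 0 = 0 := by decide
  simp only [Set.preimage_ofPred_eq, Equiv.swap_apply_left, Equiv.swap_apply_right, h0] at h
  rw [Set.inter_right_comm (X 0 ⁻¹' A) (X 1 ⁻¹' C)]
  exact h

end Exchangeable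

/-! ### Joint laws of the first draws -/

namespace IsMVPS

variable {Ω E : Type*} {mΩ : MeasurableSpace Ω} {mE : MeasurableSpace E} {μ : Measure Ω}
  {θ : ℝ} {ν : Measure E} {R : E → Measure E} {X : ℕ → Ω → E}

theorem measurable_reinf_apply (hX : IsMVPS μ θ ν R X) {A : Set E} (hA : MeasurableSet A) :
    Measurable fun x => R x A :=
  (Measure.measurable_coe hA).comp hX.measurable_reinf

theorem measurableSet_nullPart (hX : IsMVPS μ θ ν R X) : MeasurableSet (nullPart R) :=
  hX.measurable_reinf_apply .univ (measurableSet_singleton 0)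

/-- The predictive rule integrated over a past event, moved to `ENNReal` so that later identities
can use `lintegral` without integrability conditions. -/
theorem measure_past_inter [IsFiniteMeasure μ] (hX : IsMVPS μ θ ν R X) {n : ℕ} (hn : 1 ≤ n)
    {S : Set (Fin n → E)} (hS : MeasurableSet S) {A : Set E} (hA : MeasurableSet A) :
    μ ((fun ω (i : Fin n) => X i ω) ⁻¹' S ∩ X n ⁻¹' A) =
      ∫⁻ ω in (fun ω (i : Fin n) => X i ω) ⁻¹' S,
        (ENNReal.ofReal θ * ν A + ∑ i : Fin n, R (X i ω) A) /
          (ENNReal.ofReal θ + ∑ i : Fin n, R (X i ω) Set.univ) ∂μ := by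
  have := hX.isProbabilityMeasure
  have := hX.finite_reinf
  have hθ := hX.theta_pos
  have hpast : Measurable (fun ω (i : Fin n) => X i ω) :=
    measurable_pi_lambda _ fun i => hX.measurable_seq i
  have hXA : MeasurableSet (X n ⁻¹' A) := hX.measurable_seq n hA
  have hint : Integrable ((X n ⁻¹' A).indicator fun _ => (1 : ℝ)) μ :=
    (integrable_const _).indicator hXA
  have hset : MeasurableSet[pastSigma X n] ((fun ω (i : Fin n) => X i ω) ⁻¹' S) := ⟨S, hS, rfl⟩
  have hpred := hX.predictive n hn A hA
  have h := setIntegral_condExp hpast.comap_le hint hset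
  rw [setIntegral_congr_ae (hpast hS) (hpred.mono fun ω hω _ => hω),
    setIntegral_indicator hXA, setIntegral_const, smul_eq_mul, mul_one] at h
  rw [← ofReal_measureReal, ← h, ofReal_integral_eq_lintegral_ofReal
    (integrable_condExp.congr hpred).integrableOn (ae_of_all _ fun ω => by positivity)]
  refine lintegral_congr fun ω => ?_
  rw [ENNReal.ofReal_div_of_pos (by positivity), ENNReal.ofReal_add (by positivity) (by positivity),
    ENNReal.ofReal_add (by positivity) (by positivity), ENNReal.ofReal_mul hθ.le,
    ENNReal.ofReal_sum_of_nonneg (fun _ _ => measureReal_nonneg),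
    ENNReal.ofReal_sum_of_nonneg (fun _ _ => measureReal_nonneg)]
  have hR (x : E) (s : Set E) : ENNReal.ofReal ((R x).real s) = R x s := ofReal_measureReal
  simp only [hR]
  rw [ofReal_measureReal]

theorem measure_first_inter [IsFiniteMeasure μ] (hX : IsMVPS μ θ ν R X) (hcan : IsCanonical R)
    {A B : Set E} (hA : MeasurableSet A) (hAZ : A ⊆ (nullPart R)ᶜ) (hB : MeasurableSet B) :
    (ENNReal.ofReal θ + 1) * μ (X 0 ⁻¹' A ∩ X 1 ⁻¹' B) =
      ENNReal.ofReal θ * ν B * ν A + ∫⁻ x in A, R x B ∂ν := by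
  have h := hX.measure_past_inter le_rfl (S := {x | x 0 ∈ A}) (measurable_pi_apply 0 hA) hB
  have hset : (fun ω (i : Fin 1) => X i ω) ⁻¹' {x | x 0 ∈ A} = X 0 ⁻¹' A := rfl
  have ht : ENNReal.ofReal θ + 1 ≠ ⊤ := by simp
  have hm := hX.measurable_reinf_apply hB
  rw [hset] at h
  simp only [Finset.univ_unique, Fin.default_eq_zero, Fin.isValue, Fin.val_eq_zero,
    Finset.sum_singleton] at h
  rw [h, setLIntegral_congr_fun (g := fun ω => (ENNReal.ofReal θ + 1)⁻¹ *
    (ENNReal.ofReal θ * ν B + R (X 0 ω) B)) (hX.measurable_seq 0 hA)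
    (fun ω hω => by
      simp only [hcan _ (hAZ hω)]
      rw [ENNReal.div_eq_inv_mul]),
    lintegral_const_mul' _ _ (by simp), ← mul_assoc, ENNReal.mul_inv_cancel (by simp) ht, one_mul,
    ← setLIntegral_map (f := fun x => ENNReal.ofReal θ * ν B + R x B) hA (hm.const_add _)
      (hX.measurable_seq 0), hX.law_first, lintegral_add_left measurable_const,
    setLIntegral_const]

/-- A draw from Z leaves the urn unchanged, so the next draw again has law ν. -/
theorem measure_first_inter_of_subset_nullPart [IsFiniteMeasure μ] (hX : IsMVPS μ θ ν R X)
    {A B : Set E} (hA : MeasurableSet A) (hAZ : A ⊆ nullPart R) (hB : MeasurableSet B) :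
    μ (X 0 ⁻¹' A ∩ X 1 ⁻¹' B) = ν B * ν A := by
  have h := hX.measure_past_inter le_rfl (S := {x | x 0 ∈ A}) (measurable_pi_apply 0 hA) hB
  have hset : (fun ω (i : Fin 1) => X i ω) ⁻¹' {x | x 0 ∈ A} = X 0 ⁻¹' A := rfl
  rw [hset] at h
  simp only [Finset.univ_unique, Fin.default_eq_zero, Fin.isValue, Fin.val_eq_zero,
    Finset.sum_singleton] at h
  rw [h, setLIntegral_congr_fun (g := fun _ => ν B) (hX.measurable_seq 0 hA)
    (fun ω hω => by
      simp only [Measure.measure_univ_eq_zero.1 (hAZ hω), Measure.coe_zero, Pi.zero_apply, add_zero]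
      rw [mul_comm, ENNReal.mul_div_cancel_right (by simpa using hX.theta_pos) (by simp)]),
    setLIntegral_const, ← hX.law_first, Measure.map_apply (hX.measurable_seq 0) hA]

/-- The reinforcement as a kernel. -/
noncomputable def reinfKernel (hX : IsMVPS μ θ ν R X) : Kernel E E := ⟨R, hX.measurable_reinf⟩

theorem reinfKernel_apply (hX : IsMVPS μ θ ν R X) (x : E) : hX.reinfKernel x = R x := rfl

theorem isFiniteKernel_reinfKernel (hX : IsMVPS μ θ ν R X) (hcan : IsCanonical R) :
    IsFiniteKernel hX.reinfKernel := by
  refine ⟨1, by simp, fun x => ?_⟩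
  rw [reinfKernel_apply]
  by_cases hx : x ∈ nullPart R
  · rw [show R x Set.univ = 0 from hx]
    exact zero_le_one
  · exact (hcan x hx).le

/-- Upgrades the rectangle formula to an identity of measures, so that functions of both draws can
be integrated; the third predictive law needs this. -/
theorem smul_map_prodMk [IsFiniteMeasure μ] (hX : IsMVPS μ θ ν R X) (hcan : IsCanonical R) :
    (ENNReal.ofReal θ + 1) •
        (μ.restrict (X 0 ⁻¹' (nullPart R)ᶜ)).map (fun ω => (X 0 ω, X 1 ω)) =
      ENNReal.ofReal θ • (ν.restrict (nullPart R)ᶜ).prod ν +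
        (ν.restrict (nullPart R)ᶜ) ⊗ₘ hX.reinfKernel := by
  have := hX.isProbabilityMeasure
  have := hX.isFiniteKernel_reinfKernel hcan
  have hZ := hX.measurableSet_nullPart
  have hX01 : Measurable fun ω => (X 0 ω, X 1 ω) :=
    (hX.measurable_seq 0).prodMk (hX.measurable_seq 1)
  have : IsFiniteMeasure ((ENNReal.ofReal θ + 1) •
      (μ.restrict (X 0 ⁻¹' (nullPart R)ᶜ)).map (fun ω => (X 0 ω, X 1 ω))) :=
    Measure.smul_finite _ (by simp)
  refine Measure.ext_prod fun {A B} hA hB => ?_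
  have h := hX.measure_first_inter hcan (hA.inter hZ.compl) Set.inter_subset_right hB
  rw [Measure.add_apply, Measure.smul_apply, Measure.smul_apply,
    Measure.map_apply hX01 (hA.prod hB), Measure.restrict_apply (hX01 (hA.prod hB)),
    Measure.prod_prod, Measure.compProd_apply_prod hA hB, Measure.restrict_apply hA,
    Measure.restrict_restrict hA, smul_eq_mul, smul_eq_mul, mul_comm (ν _), ← mul_assoc]
  refine Eq.trans ?_ h
  congr 2
  ext ω
  simp only [Set.mem_inter_iff, Set.mem_preimage, Set.mem_prod]
  tauto

theorem setLIntegral_pair [IsFiniteMeasure μ] (hX : IsMVPS μ θ ν R X) (hcan : IsCanonical R)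
    {A B : Set E} (hA : MeasurableSet A) (hAZ : A ⊆ (nullPart R)ᶜ) (hB : MeasurableSet B)
    {f : E → E → ENNReal} (hf : Measurable (Function.uncurry f)) :
    (ENNReal.ofReal θ + 1) * ∫⁻ ω in X 0 ⁻¹' A ∩ X 1 ⁻¹' B, f (X 0 ω) (X 1 ω) ∂μ =
      ENNReal.ofReal θ * ∫⁻ x in A, ∫⁻ y in B, f x y ∂ν ∂ν +
        ∫⁻ x in A, ∫⁻ y in B, f x y ∂(R x) ∂ν := by
  have := hX.isProbabilityMeasure
  have := hX.isFiniteKernel_reinfKernel hcan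
  have hZ := hX.measurableSet_nullPart
  have hX01 : Measurable fun ω => (X 0 ω, X 1 ω) :=
    (hX.measurable_seq 0).prodMk (hX.measurable_seq 1)
  have h := congrArg (fun m => ∫⁻ z in A ×ˢ B, Function.uncurry f z ∂m) (hX.smul_map_prodMk hcan)
  simp only [Measure.restrict_smul, Measure.restrict_add, lintegral_smul_measure,
    lintegral_add_measure, smul_eq_mul] at h
  rw [setLIntegral_map (hA.prod hB) hf hX01, Measure.restrict_restrict (hX01 (hA.prod hB)),
    Measure.setLIntegral_compProd hf hA hB, ← Measure.prod_restrict, lintegral_prod _ hf.aemeasurable,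
    Measure.restrict_restrict hA, Set.inter_eq_left.2 hAZ] at h
  refine Eq.trans ?_ h
  congr 3
  ext ω
  simp only [Set.mem_inter_iff, Set.mem_preimage, Set.mem_prod]
  have := @hAZ (X 0 ω)
  tauto

theorem measure_first_inter_inter [IsFiniteMeasure μ] (hX : IsMVPS μ θ ν R X) (hcan : IsCanonical R)
    {A B C : Set E} (hA : MeasurableSet A) (hAZ : A ⊆ (nullPart R)ᶜ) (hB : MeasurableSet B)
    (hBZ : B ⊆ (nullPart R)ᶜ) (hC : MeasurableSet C) :
    (ENNReal.ofReal θ + 2) * μ (X 0 ⁻¹' A ∩ X 1 ⁻¹' B ∩ X 2 ⁻¹' C) =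
      ∫⁻ ω in X 0 ⁻¹' A ∩ X 1 ⁻¹' B,
        (ENNReal.ofReal θ * ν C + (R (X 0 ω) C + R (X 1 ω) C)) ∂μ := by
  have hS : MeasurableSet {x : Fin 2 → E | x 0 ∈ A ∧ x 1 ∈ B} :=
    (measurable_pi_apply 0 hA).inter (measurable_pi_apply 1 hB)
  have h := hX.measure_past_inter one_le_two hS hC
  have hset : (fun ω (i : Fin 2) => X i ω) ⁻¹' {x | x 0 ∈ A ∧ x 1 ∈ B} =
    X 0 ⁻¹' A ∩ X 1 ⁻¹' B := rfl
  simp only [Fin.sum_univ_two, Fin.val_zero, Fin.val_one] at h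
  have ht : ENNReal.ofReal θ + 2 ≠ ⊤ := by simp
  rw [hset] at h
  rw [h, setLIntegral_congr_fun (g := fun ω => (ENNReal.ofReal θ + 2)⁻¹ *
    (ENNReal.ofReal θ * ν C + (R (X 0 ω) C + R (X 1 ω) C)))
    ((hX.measurable_seq 0 hA).inter (hX.measurable_seq 1 hB))
    (fun ω hω => by
      simp only [hcan _ (hAZ hω.1), hcan _ (hBZ hω.2), one_add_one_eq_two]
      rw [ENNReal.div_eq_inv_mul]),
    lintegral_const_mul' _ _ (by simp), ← mul_assoc, ENNReal.mul_inv_cancel (by simp) ht, one_mul]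

end IsMVPS

/-! ### Truncated squares, countable generation, conditional kernels -/

/-- Subtraction is truncated, so one of the two squared differences vanishes and their sum plays the
role of |a - b|². -/
theorem ENNReal.sq_add_sq_eq {a b : ENNReal} (ha : a ≠ ⊤) (hb : b ≠ ⊤) :
    a ^ 2 + b ^ 2 = 2 * a * b + ((a - b) ^ 2 + (b - a) ^ 2) := by
  have key {a b : ENNReal} (ha : a ≠ ⊤) (h : a ≤ b) :
      a ^ 2 + b ^ 2 = 2 * a * b + ((a - b) ^ 2 + (b - a) ^ 2) := by
    obtain ⟨c, rfl⟩ := exists_add_of_le h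
    rw [tsub_eq_zero_of_le h, ENNReal.add_sub_cancel_left ha]
    ring
  rcases le_total a b with h | h
  · exact key ha h
  · have := key hb h
    rw [add_comm, this]
    ring

theorem MeasurableSpace.exists_countable_isPiSystem (E : Type*) [m : MeasurableSpace E]
    [MeasurableSpace.CountablyGenerated E] :
    ∃ S : Set (Set E), S.Countable ∧ IsPiSystem S ∧ Set.univ ∈ S ∧ m = generateFrom S := by
  have h := isSetAlgebra_generateSetAlgebra (𝒜 := countableGeneratingSet E)
  refine ⟨generateSetAlgebra (countableGeneratingSet E),
    countable_generateSetAlgebra countable_countableGeneratingSet,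
    fun s hs t ht _ => h.inter_mem hs ht, h.univ_mem, ?_⟩
  rw [generateFrom_generateSetAlgebra_eq, generateFrom_countableGeneratingSet]

/-- A finite measure is determined by its values on a countable π-system containing the whole space,
so σ(R) is pulled back from a countable product. -/
theorem MeasurableSpace.countablyGenerated_comap_measure {E F : Type*} [MeasurableSpace E]
    [MeasurableSpace.CountablyGenerated E] (R : F → Measure E) [∀ x, IsFiniteMeasure (R x)] :
    @MeasurableSpace.CountablyGenerated F (MeasurableSpace.comap R Measure.instMeasurableSpace) := by
  obtain ⟨S, hSc, hSpi, hSu, hSgen⟩ := exists_countable_isPiSystem E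
  have : Countable S := hSc
  have heq : MeasurableSpace.comap R Measure.instMeasurableSpace =
      MeasurableSpace.comap (fun x (s : S) => R x s) MeasurableSpace.pi := by
    refine le_antisymm (Measurable.comap_le ?_) (Measurable.comap_le ?_)
    · let := MeasurableSpace.comap (fun x (s : S) => R x s) MeasurableSpace.pi
      have hm (s : Set E) (hs : s ∈ S) : Measurable fun x => R x s :=
        (measurable_pi_apply (⟨s, hs⟩ : S)).comp (comap_measurable fun x (s : S) => R x s)
      exact Measurable.measure_of_isPiSystem hSgen hSpi hm (hm _ hSu)
    · let := MeasurableSpace.comap R Measure.instMeasurableSpace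
      refine measurable_pi_lambda _ fun s => ?_
      exact (Measure.measurable_coe (hSgen ▸ measurableSet_generateFrom s.2)).comp
        (comap_measurable R)
  rw [heq]
  exact MeasurableSpace.CountablyGenerated.comap _

/-- The σ-algebra generated by a measure-valued map. -/
abbrev reinfSigma {E F : Type*} {mE : MeasurableSpace E} (R : F → Measure E) : MeasurableSpace F :=
  MeasurableSpace.comap R Measure.instMeasurableSpace

theorem measurable_reinfSigma_apply {E F : Type*} [MeasurableSpace E] (R : F → Measure E)
    {s : Set E} (hs : MeasurableSet s) :
    Measurable[reinfSigma R] fun x => R x s := by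
  let := reinfSigma R
  exact (Measure.measurable_coe hs).comp (comap_measurable R)

/-- Evaluates on a rectangle the disintegration of the image of ν on the diagonal. -/
theorem setLIntegral_condExpKernel_apply {E : Type*} {G mE : MeasurableSpace E}
    [StandardBorelSpace E] (hG : G ≤ mE) (ν : Measure E) [IsFiniteMeasure ν] {A B : Set E}
    (hA : MeasurableSet A) (hB : MeasurableSet[G] B) :
    ∫⁻ x in B, condExpKernel ν G x A ∂ν = ν (B ∩ A) := by
  have h := congrArg (fun m => m (B ×ˢ A)) (compProd_trim_condExpKernel (μ := ν) hG)
  have hdiag : @Measurable E (E × E) mE (G.prod mE) Function.diag :=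
    (measurable_id.mono le_rfl hG).prodMk measurable_id
  rw [Measure.compProd_apply_prod hB hA, Measure.map_apply hdiag (hB.prod hA),
    setLIntegral_trim hG (measurable_condExpKernel hA) hB] at h
  exact h

/-! ### Consequences of swapping the first two draws -/

namespace IsMVPS

variable {Ω E : Type*} {mΩ : MeasurableSpace Ω} {mE : MeasurableSpace E} {μ : Measure Ω}
  {θ : ℝ} {ν : Measure E} {R : E → Measure E} {X : ℕ → Ω → E}

theorem _root_.IsCanonical.apply_le_one (hcan : IsCanonical R) (x : E) (A : Set E) :
    R x A ≤ 1 := by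
  refine (measure_mono (Set.subset_univ A)).trans ?_
  by_cases hx : x ∈ nullPart R
  · rw [show R x Set.univ = 0 from hx]
    exact zero_le_one
  · exact (hcan x hx).le

theorem setLIntegral_ne_top_of_le_one (hX : IsMVPS μ θ ν R X) {f : E → ENNReal}
    (hf : ∀ x, f x ≤ 1) (A : Set E) : ∫⁻ x in A, f x ∂ν ≠ ⊤ := by
  have := hX.isProbabilityMeasure
  refine ((lintegral_mono hf).trans_lt ?_).ne
  rw [lintegral_one]
  exact measure_lt_top _ _

/-- Reversibility: the base term θ ν(A) ν(B) is symmetric and finite, so it cancels from the two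
orders of drawing. -/
theorem setLIntegral_reinf_comm [IsFiniteMeasure μ] (hX : IsMVPS μ θ ν R X)
    (hcan : IsCanonical R) (hexch : Exchangeable μ X) {A B : Set E} (hA : MeasurableSet A)
    (hAZ : A ⊆ (nullPart R)ᶜ) (hB : MeasurableSet B) (hBZ : B ⊆ (nullPart R)ᶜ) :
    ∫⁻ x in A, R x B ∂ν = ∫⁻ x in B, R x A ∂ν := by
  have := hX.isProbabilityMeasure
  have h1 := hX.measure_first_inter hcan hA hAZ hB
  have h2 := hX.measure_first_inter hcan hB hBZ hA
  rw [hexch.measure_inter_comm hA hB, h2, mul_right_comm] at h1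
  exact ((ENNReal.add_right_inj (by finiteness)).1 h1).symm

/-- Drawing B first gives ν(A) ν(B) exactly. Multiplied by θ + 1, this exceeds the base term of the
opposite order by one copy of ν(A) ν(B), which the reinforcement must supply. -/
theorem setLIntegral_reinf_of_subset_nullPart [IsFiniteMeasure μ] (hX : IsMVPS μ θ ν R X)
    (hcan : IsCanonical R) (hexch : Exchangeable μ X) {A B : Set E} (hA : MeasurableSet A)
    (hAZ : A ⊆ (nullPart R)ᶜ) (hB : MeasurableSet B) (hBZ : B ⊆ nullPart R) :
    ∫⁻ x in A, R x B ∂ν = ν B * ν A := by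
  have := hX.isProbabilityMeasure
  have h := hX.measure_first_inter hcan hA hAZ hB
  rw [hexch.measure_inter_comm hA hB, hX.measure_first_inter_of_subset_nullPart hB hBZ hA,
    add_mul, one_mul, mul_comm (ν A), ← mul_assoc] at h
  exact ((ENNReal.add_right_inj (by finiteness)).1 h).symm

theorem ae_eq_of_forall_setLIntegral_eq_of_subset [IsFiniteMeasure ν] {S : Set E}
    (hS : MeasurableSet S) {f g : E → ENNReal} (hf : Measurable f) (hg : Measurable g)
    (h : ∀ A, MeasurableSet A → A ⊆ S → ∫⁻ x in A, f x ∂ν = ∫⁻ x in A, g x ∂ν) :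
    ∀ᵐ x ∂ν.restrict S, f x = g x := by
  refine ae_eq_of_forall_setLIntegral_eq_of_sigmaFinite hf hg fun A hA _ => ?_
  rw [Measure.restrict_restrict hA]
  exact h _ (hA.inter hS) Set.inter_subset_right

theorem reinf_ae_eq_of_subset_nullPart [IsFiniteMeasure μ] (hX : IsMVPS μ θ ν R X)
    (hcan : IsCanonical R) (hexch : Exchangeable μ X) {B : Set E} (hB : MeasurableSet B)
    (hBZ : B ⊆ nullPart R) : ∀ᵐ x ∂ν.restrict (nullPart R)ᶜ, R x B = ν B := by
  have := hX.isProbabilityMeasure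
  refine ae_eq_of_forall_setLIntegral_eq_of_subset hX.measurableSet_nullPart.compl
    (hX.measurable_reinf_apply hB) measurable_const fun A hA hAZ => ?_
  rw [hX.setLIntegral_reinf_of_subset_nullPart hcan hexch hA hAZ hB hBZ, setLIntegral_const]

theorem reinf_compl_nullPart_ae_eq [IsFiniteMeasure μ] (hX : IsMVPS μ θ ν R X)
    (hcan : IsCanonical R) (hexch : Exchangeable μ X) :
    ∀ᵐ x ∂ν.restrict (nullPart R)ᶜ, R x (nullPart R)ᶜ = ν (nullPart R)ᶜ := by
  have := hX.isProbabilityMeasure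
  have hZ := hX.measurableSet_nullPart
  filter_upwards [hX.reinf_ae_eq_of_subset_nullPart hcan hexch hZ subset_rfl,
    ae_restrict_mem hZ.compl] with x hx hxZ
  have := hX.finite_reinf x
  rw [measure_compl hZ (measure_ne_top _ _), measure_compl hZ (measure_ne_top _ _), hx,
    hcan x hxZ, measure_univ]

/-- Invariance follows from reversibility, taking Zᶜ as one of the two sets. -/
theorem bind_restrict_reinfKernel [IsFiniteMeasure μ] (hX : IsMVPS μ θ ν R X)
    (hcan : IsCanonical R) (hexch : Exchangeable μ X) :
    (ν.restrict (nullPart R)ᶜ).bind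
        (hX.reinfKernel.restrict hX.measurableSet_nullPart.compl) =
      ν (nullPart R)ᶜ • ν.restrict (nullPart R)ᶜ := by
  have hZ := hX.measurableSet_nullPart
  ext A hA
  rw [Measure.bind_apply hA (Kernel.aemeasurable _), Measure.smul_apply,
    Measure.restrict_apply hA, smul_eq_mul]
  simp only [Kernel.restrict_apply, reinfKernel_apply, Measure.restrict_apply hA]
  rw [hX.setLIntegral_reinf_comm hcan hexch hZ.compl subset_rfl (hA.inter hZ.compl)
    Set.inter_subset_right, ← setLIntegral_const]
  exact lintegral_congr_ae (ae_mono (Measure.restrict_mono Set.inter_subset_right le_rfl)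
    (hX.reinf_compl_nullPart_ae_eq hcan hexch))

theorem lintegral_lintegral_reinf [IsFiniteMeasure μ] (hX : IsMVPS μ θ ν R X)
    (hcan : IsCanonical R) (hexch : Exchangeable μ X) {g : E → ENNReal} (hg : Measurable g) :
    ∫⁻ x in (nullPart R)ᶜ, ∫⁻ y in (nullPart R)ᶜ, g y ∂(R x) ∂ν =
      ν (nullPart R)ᶜ * ∫⁻ y in (nullPart R)ᶜ, g y ∂ν := by
  have h := congrArg (fun m => ∫⁻ y, g y ∂m) (hX.bind_restrict_reinfKernel hcan hexch)
  rw [← smul_eq_mul, ← lintegral_smul_measure, ← h]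
  rw [Measure.lintegral_bind (Kernel.aemeasurable _) hg.aemeasurable]
  simp only [Kernel.restrict_apply, reinfKernel_apply]

theorem ae_ae_reinf [IsFiniteMeasure μ] (hX : IsMVPS μ θ ν R X)
    (hcan : IsCanonical R) (hexch : Exchangeable μ X) {P : E → Prop}
    (hP : ∀ᵐ y ∂ν.restrict (nullPart R)ᶜ, P y) :
    ∀ᵐ x ∂ν.restrict (nullPart R)ᶜ, ∀ᵐ y ∂(R x).restrict (nullPart R)ᶜ, P y := by
  have h := Measure.ae_ae_of_ae_bind (p := P)
    (Kernel.aemeasurable (hX.reinfKernel.restrict hX.measurableSet_nullPart.compl))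
    (by rw [hX.bind_restrict_reinfKernel hcan hexch]; exact Measure.ae_smul_measure hP _)
  filter_upwards [h] with x hx
  rwa [Kernel.restrict_apply, reinfKernel_apply] at hx

/-! ### Swapping the second and third draws: R is constant along its own moves -/

theorem setLIntegral_setLIntegral_reinf_comm [IsFiniteMeasure μ] (hX : IsMVPS μ θ ν R X)
    (hcan : IsCanonical R) (hexch : Exchangeable μ X) {A B C : Set E} (hA : MeasurableSet A)
    (hAZ : A ⊆ (nullPart R)ᶜ) (hB : MeasurableSet B) (hBZ : B ⊆ (nullPart R)ᶜ)
    (hC : MeasurableSet C) (hCZ : C ⊆ (nullPart R)ᶜ) :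
    ∫⁻ x in A, ∫⁻ y in B, R y C ∂(R x) ∂ν = ∫⁻ x in A, ∫⁻ y in C, R y B ∂(R x) ∂ν := by
  have := hX.isProbabilityMeasure
  have := hX.isFiniteKernel_reinfKernel hcan
  have key {B C : Set E} (hB : MeasurableSet B) (hBZ : B ⊆ (nullPart R)ᶜ)
      (hC : MeasurableSet C) :
      (ENNReal.ofReal θ + 1) *
          ((ENNReal.ofReal θ + 2) * μ (X 0 ⁻¹' A ∩ X 1 ⁻¹' B ∩ X 2 ⁻¹' C)) =
        ENNReal.ofReal θ * (ENNReal.ofReal θ * ν C * ν B * ν A +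
            (ν B * ∫⁻ x in A, R x C ∂ν + (∫⁻ y in B, R y C ∂ν) * ν A)) +
          (ENNReal.ofReal θ * ν C * ∫⁻ x in A, R x B ∂ν + ∫⁻ x in A, R x C * R x B ∂ν) +
          ∫⁻ x in A, ∫⁻ y in B, R y C ∂(R x) ∂ν := by
    have hmB := hX.measurable_reinf_apply hB
    have hmC := hX.measurable_reinf_apply hC
    rw [hX.measure_first_inter_inter hcan hA hAZ hB hBZ hC,
      hX.setLIntegral_pair hcan hA hAZ hB
        (f := fun x y => ENNReal.ofReal θ * ν C + (R x C + R y C))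
        (((hmC.comp measurable_fst).add (hmC.comp measurable_snd)).const_add _)]
    have h (x : E) (m : Measure E) :
        ∫⁻ y in B, (ENNReal.ofReal θ * ν C + (R x C + R y C)) ∂m =
          ENNReal.ofReal θ * ν C * m B + (R x C * m B + ∫⁻ y in B, R y C ∂m) := by
      rw [lintegral_add_left measurable_const, lintegral_add_left measurable_const,
        setLIntegral_const, setLIntegral_const]
    simp only [h]
    rw [lintegral_add_left measurable_const, lintegral_add_left (hmC.mul_const _),
      lintegral_add_left (hmB.const_mul _), lintegral_add_left (f := fun x => R x C * R x B) (hmC.mul hmB),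
      lintegral_mul_const _ hmC, lintegral_const_mul _ hmB, setLIntegral_const, setLIntegral_const,
      mul_comm (ν B) (∫⁻ x in A, R x C ∂ν), ← add_assoc (ENNReal.ofReal θ * ν C * _)]
    rw [add_assoc, add_assoc, add_assoc]
  have hBC := key hB hBZ hC
  rw [hexch.measure_inter_inter_comm hA hB hC, key hC hCZ hB,
    hX.setLIntegral_reinf_comm hcan hexch hC hCZ hB hBZ] at hBC
  have hr (D : Set E) : ∫⁻ x in A, R x D ∂ν ≠ ⊤ :=
    hX.setLIntegral_ne_top_of_le_one (fun x => hcan.apply_le_one x D) A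
  have hrr : ∫⁻ x in A, R x B * R x C ∂ν ≠ ⊤ :=
    hX.setLIntegral_ne_top_of_le_one
      (fun x => mul_le_one' (hcan.apply_le_one x B) (hcan.apply_le_one x C)) A
  have hJ : ∫⁻ x in B, R x C ∂ν ≠ ⊤ :=
    hX.setLIntegral_ne_top_of_le_one (fun x => hcan.apply_le_one x C) B
  have hcomm : ∫⁻ x in A, R x C * R x B ∂ν = ∫⁻ x in A, R x B * R x C ∂ν := by
    simp only [mul_comm]
  have hB' := hr B
  have hC' := hr C
  rw [hcomm] at hBC
  generalize ∫⁻ x in A, R x B * R x C ∂ν = s at *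
  generalize ∫⁻ x in A, R x B ∂ν = rB at *
  generalize ∫⁻ x in A, R x C ∂ν = rC at *
  generalize ∫⁻ x in B, R x C ∂ν = J at *
  -- All terms but the double integral are symmetric in B and C, the integral `J` by reversibility;
  -- being finite, they cancel.
  refine ((ENNReal.add_right_inj (a := ENNReal.ofReal θ * (ENNReal.ofReal θ * ν B * ν C * ν A +
    (ν C * rB + J * ν A)) + (ENNReal.ofReal θ * ν B * rC + s)) (by finiteness)).1 ?_).symm
  rw [hBC]
  ring

/-- Swap C with B = Zᶜ; after the swap the inner integrand R_y(Zᶜ) is q for R_x-almost every y. -/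
theorem setLIntegral_reinf_reinf_ae_eq_of_subset [IsFiniteMeasure μ] (hX : IsMVPS μ θ ν R X)
    (hcan : IsCanonical R) (hexch : Exchangeable μ X) {C : Set E} (hC : MeasurableSet C)
    (hCZ : C ⊆ (nullPart R)ᶜ) :
    ∀ᵐ x ∂ν.restrict (nullPart R)ᶜ,
      ∫⁻ y in (nullPart R)ᶜ, R y C ∂(R x) = ν (nullPart R)ᶜ * R x C := by
  have := hX.isProbabilityMeasure
  have hZ := hX.measurableSet_nullPart
  have := hX.isFiniteKernel_reinfKernel hcan
  have hmC := hX.measurable_reinf_apply hC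
  have hm : Measurable fun x => ∫⁻ y in (nullPart R)ᶜ, R y C ∂(R x) :=
    hmC.setLIntegral_kernel (κ := hX.reinfKernel) hZ.compl
  refine ae_eq_of_forall_setLIntegral_eq_of_subset hZ.compl hm
    (hmC.const_mul _) fun A hA hAZ => ?_
  rw [hX.setLIntegral_setLIntegral_reinf_comm hcan hexch hA hAZ hZ.compl subset_rfl hC hCZ]
  refine lintegral_congr_ae (ae_mono (Measure.restrict_mono hAZ le_rfl) ?_)
  filter_upwards [hX.ae_ae_reinf hcan hexch (hX.reinf_compl_nullPart_ae_eq hcan hexch)] with x hx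
  rw [← setLIntegral_const]
  exact lintegral_congr_ae (ae_mono (Measure.restrict_mono hCZ le_rfl) hx)

theorem setLIntegral_reinf_reinf_ae_eq [IsFiniteMeasure μ] (hX : IsMVPS μ θ ν R X)
    (hcan : IsCanonical R) (hexch : Exchangeable μ X) {C : Set E} (hC : MeasurableSet C) :
    ∀ᵐ x ∂ν.restrict (nullPart R)ᶜ,
      ∫⁻ y in (nullPart R)ᶜ, R y C ∂(R x) = ν (nullPart R)ᶜ * R x C := by
  have hZ := hX.measurableSet_nullPart
  have hnull := hX.reinf_ae_eq_of_subset_nullPart hcan hexch (hC.inter hZ) Set.inter_subset_right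
  filter_upwards [hX.setLIntegral_reinf_reinf_ae_eq_of_subset hcan hexch (hC.diff hZ)
      fun _ h => h.2, hnull, hX.ae_ae_reinf hcan hexch hnull,
      hX.reinf_compl_nullPart_ae_eq hcan hexch] with x h1 h2 h3 h4
  have hsplit (y : E) : R y C = R y (C ∩ nullPart R) + R y (C \ nullPart R) :=
    (measure_inter_add_sdiff C hZ).symm
  rw [hsplit x, mul_add, ← h1, lintegral_congr hsplit,
    lintegral_add_left (hX.measurable_reinf_apply (hC.inter hZ)), lintegral_congr_ae h3,
    setLIntegral_const, h4, h2, mul_comm]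

/-- A variance argument. Expanding the square of R_y(C) - R_x(C), invariance makes each square
integrate to `I`, while idempotence makes the cross term 2`I`. Since `I` is finite, the integrated
square is zero. -/
theorem reinf_apply_ae_ae_eq [IsFiniteMeasure μ] (hX : IsMVPS μ θ ν R X)
    (hcan : IsCanonical R) (hexch : Exchangeable μ X) {C : Set E} (hC : MeasurableSet C) :
    ∀ᵐ x ∂ν.restrict (nullPart R)ᶜ, ∀ᵐ y ∂(R x).restrict (nullPart R)ᶜ, R y C = R x C := by
  have := hX.isProbabilityMeasure
  have := hX.isFiniteKernel_reinfKernel hcan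
  have hZ := hX.measurableSet_nullPart
  have hm := hX.measurable_reinf_apply hC
  have hmsq : Measurable fun x => ∫⁻ y in (nullPart R)ᶜ, R y C ^ 2 ∂(R x) :=
    (hm.pow_const 2).lintegral_kernel (κ := hX.reinfKernel.restrict hZ.compl)
  have hfin (x : E) : R x C ≠ ⊤ := ((hcan.apply_le_one x C).trans_lt ENNReal.one_lt_top).ne
  set D : E → E → ENNReal := fun x y => (R y C - R x C) ^ 2 + (R x C - R y C) ^ 2 with hD
  have hDm : Measurable (Function.uncurry D) := by
    have h1 := hm.comp (measurable_fst : Measurable (Prod.fst : E × E → E))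
    have h2 := hm.comp (measurable_snd : Measurable (Prod.snd : E × E → E))
    exact ((h2.sub h1).pow_const 2).add ((h1.sub h2).pow_const 2)
  have hDint : Measurable fun x => ∫⁻ y in (nullPart R)ᶜ, D x y ∂(R x) :=
    Measurable.lintegral_kernel_prod_right (κ := hX.reinfKernel.restrict hZ.compl) hDm
  set I : ENNReal := ν (nullPart R)ᶜ * ∫⁻ y in (nullPart R)ᶜ, R y C ^ 2 ∂ν with hI
  have hItop : I ≠ ⊤ := ENNReal.mul_ne_top (measure_ne_top _ _)
    (hX.setLIntegral_ne_top_of_le_one (fun x => pow_le_one' (hcan.apply_le_one x C) 2) _)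
  have hpt (x : E) : (∫⁻ y in (nullPart R)ᶜ, R y C ^ 2 ∂(R x)) + R x C ^ 2 * R x (nullPart R)ᶜ =
      2 * R x C * (∫⁻ y in (nullPart R)ᶜ, R y C ∂(R x)) +
        ∫⁻ y in (nullPart R)ᶜ, D x y ∂(R x) := by
    rw [← setLIntegral_const, ← lintegral_add_left (hm.pow_const 2), ← lintegral_const_mul _ hm,
      ← lintegral_add_left (hm.const_mul _)]
    refine lintegral_congr fun y => ?_
    rw [ENNReal.sq_add_sq_eq (hfin y) (hfin x), mul_right_comm]
  have hsum : I + I = I + I + ∫⁻ x in (nullPart R)ᶜ, ∫⁻ y in (nullPart R)ᶜ, D x y ∂(R x) ∂ν := by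
    have hL : ∫⁻ x in (nullPart R)ᶜ, ((∫⁻ y in (nullPart R)ᶜ, R y C ^ 2 ∂(R x)) +
        R x C ^ 2 * R x (nullPart R)ᶜ) ∂ν = I + I := by
      rw [lintegral_add_left hmsq,
        hX.lintegral_lintegral_reinf hcan hexch (hm.pow_const 2), hI,
        ← lintegral_const_mul _ (hm.pow_const 2)]
      congr 1
      refine lintegral_congr_ae ?_
      filter_upwards [hX.reinf_compl_nullPart_ae_eq hcan hexch] with x hx
      rw [hx, mul_comm]
    rw [lintegral_congr hpt, lintegral_add_right _ hDint] at hL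
    refine hL.symm.trans ?_
    congr 1
    rw [hI, ← two_mul, ← lintegral_const_mul _ (hm.pow_const 2),
      ← lintegral_const_mul _ ((hm.pow_const 2).const_mul _)]
    refine lintegral_congr_ae ?_
    filter_upwards [hX.setLIntegral_reinf_reinf_ae_eq hcan hexch hC] with x hx
    rw [hx]
    ring
  have hzero : ∫⁻ x in (nullPart R)ᶜ, ∫⁻ y in (nullPart R)ᶜ, D x y ∂(R x) ∂ν = 0 :=
    ((ENNReal.add_right_inj (ENNReal.add_ne_top.2 ⟨hItop, hItop⟩)).1 (by rwa [add_zero])).symm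
  rw [lintegral_eq_zero_iff hDint] at hzero
  filter_upwards [hzero] with x hx
  rw [Pi.zero_apply, lintegral_eq_zero_iff (f := D x) (hDm.comp measurable_prodMk_left)] at hx
  filter_upwards [hx] with y hy
  simp only [hD, Pi.zero_apply, add_eq_zero,
    pow_eq_zero_iff two_ne_zero, tsub_eq_zero_iff_le] at hy
  exact le_antisymm hy.1 hy.2

theorem reinf_ae_ae_eq [MeasurableSpace.CountablyGenerated E] [IsFiniteMeasure μ]
    (hX : IsMVPS μ θ ν R X) (hcan : IsCanonical R) (hexch : Exchangeable μ X) :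
    ∀ᵐ x ∂ν.restrict (nullPart R)ᶜ, ∀ᵐ y ∂(R x).restrict (nullPart R)ᶜ, R y = R x := by
  have := hX.finite_reinf
  -- The exceptional null set depends on C; a countable determining class makes it uniform.
  obtain ⟨S, hSc, hSpi, hSu, hSgen⟩ := MeasurableSpace.exists_countable_isPiSystem E
  have h := (ae_ball_iff hSc).2 fun s hs => hX.reinf_apply_ae_ae_eq hcan hexch
    (hSgen ▸ MeasurableSpace.measurableSet_generateFrom hs)
  filter_upwards [h] with x hx
  filter_upwards [(ae_ball_iff hSc).2 hx] with y hy
  exact ext_of_generate_finite S hSgen hSpi hy (hy _ hSu)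

/-- Membership in B depends only on the value of R, which is R_x for R_x-almost every point of Zᶜ;
so B carries all or none of the mass q. -/
theorem reinf_inter_compl_ae_eq_indicator [MeasurableSpace.CountablyGenerated E]
    [IsFiniteMeasure μ] (hX : IsMVPS μ θ ν R X) (hcan : IsCanonical R) (hexch : Exchangeable μ X)
    {B : Set E} (hB : MeasurableSet[reinfSigma R] B) :
    ∀ᵐ x ∂ν.restrict (nullPart R)ᶜ,
      R x (B ∩ (nullPart R)ᶜ) = B.indicator (fun _ => ν (nullPart R)ᶜ) x := by
  have hZ := hX.measurableSet_nullPart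
  have hBE : MeasurableSet B := hX.measurable_reinf.comap_le _ hB
  obtain ⟨S, -, rfl⟩ := hB
  filter_upwards [hX.reinf_ae_ae_eq hcan hexch, hX.reinf_compl_nullPart_ae_eq hcan hexch]
    with x hx hxq
  have hxn : (R x).restrict (nullPart R)ᶜ {y | ¬R y = R x} = 0 := ae_iff.1 hx
  rw [← Measure.restrict_apply hBE]
  by_cases hxB : x ∈ R ⁻¹' S
  · rw [Set.indicator_of_mem hxB, ← hxq, ← Measure.restrict_apply_univ (μ := R x) (nullPart R)ᶜ]
    rw [measure_eq_measure_of_null_sdiff (Set.subset_univ _)]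
    refine measure_mono_null (fun y (hy : y ∈ Set.univ \ R ⁻¹' S) =>
      show ¬R y = R x from fun hyx => hy.2 ?_) hxn
    change R y ∈ S
    rw [hyx]
    exact hxB
  · rw [Set.indicator_of_notMem hxB]
    refine measure_mono_null (fun y (hy : R y ∈ S) => show ¬R y = R x from fun hyx => hxB ?_) hxn
    change R x ∈ S
    rw [← hyx]
    exact hy

/-! ### Identification with the conditional distribution given σ(R) -/

theorem condExpKernel_ae_eq_reinf [StandardBorelSpace E] [IsFiniteMeasure ν]
    [IsFiniteMeasure μ] (hX : IsMVPS μ θ ν R X) (hcan : IsCanonical R) (hexch : Exchangeable μ X)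
    {A : Set E} (hA : MeasurableSet A) (hAZ : A ⊆ (nullPart R)ᶜ) :
    ∀ᵐ x ∂ν.restrict (nullPart R)ᶜ,
      ν (nullPart R)ᶜ *
        condExpKernel ν (reinfSigma R) x A = R x A := by
  have hG : reinfSigma R ≤ mE := hX.measurable_reinf.comap_le
  have hZ := hX.measurableSet_nullPart
  have hmR {s : Set E} (hs : MeasurableSet s) : Measurable[reinfSigma R] fun x => R x s :=
    measurable_reinfSigma_apply R hs
  have hZG : MeasurableSet[reinfSigma R] (nullPart R)ᶜ := (hmR .univ (measurableSet_singleton 0)).compl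
  have hmK : Measurable[reinfSigma R] fun x => ν (nullPart R)ᶜ * condExpKernel ν (reinfSigma R) x A :=
    (measurable_condExpKernel hA).const_mul _
  refine ae_of_ae_trim hG ?_
  -- Both sides are σ(R)-measurable, so testing on B ∈ σ(R) suffices. Reversibility moves the
  -- integral of R_x(A) over B ∩ Zᶜ to that of R_x(B ∩ Zᶜ) over A, giving q ν(A ∩ B).
  refine @ae_eq_of_forall_setLIntegral_eq_of_sigmaFinite E (reinfSigma R) _ _ _ _ hmK (hmR hA) ?_
  intro B hB _
  have hBE : MeasurableSet B := hG _ hB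
  rw [setLIntegral_trim hG hmK hB, setLIntegral_trim hG (hmR hA) hB,
    Measure.restrict_restrict hBE, lintegral_const_mul' _ _ (measure_ne_top _ _),
    setLIntegral_condExpKernel_apply hG ν hA (hB.inter hZG),
    hX.setLIntegral_reinf_comm hcan hexch (hBE.inter hZ.compl) Set.inter_subset_right hA hAZ,
    lintegral_congr_ae (ae_mono (Measure.restrict_mono hAZ le_rfl)
      (hX.reinf_inter_compl_ae_eq_indicator hcan hexch hB)), lintegral_indicator hBE,
    setLIntegral_const, Measure.restrict_apply hBE, Set.inter_assoc, Set.inter_eq_right.2 hAZ]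

theorem reinf_ae_eq [StandardBorelSpace E] [IsFiniteMeasure ν] [IsFiniteMeasure μ]
    (hX : IsMVPS μ θ ν R X) (hcan : IsCanonical R) (hexch : Exchangeable μ X) :
    ∀ᵐ x ∂ν.restrict (nullPart R)ᶜ,
      R x = ν (nullPart R)ᶜ •
          condExpKernel ν (reinfSigma R) x +
        ν.restrict (nullPart R) := by
  have hZ := hX.measurableSet_nullPart
  have := hX.finite_reinf
  have hG : reinfSigma R ≤ mE := hX.measurable_reinf.comap_le
  have hZG : MeasurableSet[reinfSigma R] (nullPart R)ᶜ :=
    (measurable_reinfSigma_apply R .univ (measurableSet_singleton 0)).compl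
  obtain ⟨S, hSc, hSpi, hSu, hSgen⟩ := MeasurableSpace.exists_countable_isPiSystem E
  have hSm {s : Set E} (hs : s ∈ S) : MeasurableSet s :=
    hSgen ▸ MeasurableSpace.measurableSet_generateFrom hs
  have hker := ae_restrict_of_ae (s := (nullPart R)ᶜ)
    (condExpKernel_apply_ae_eq_indicator hG ν hZG.compl)
  have h (s : Set E) (hs : s ∈ S) : ∀ᵐ x ∂ν.restrict (nullPart R)ᶜ,
      R x s = (ν (nullPart R)ᶜ • condExpKernel ν (reinfSigma R) x + ν.restrict (nullPart R)) s := by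
    filter_upwards [hX.reinf_ae_eq_of_subset_nullPart hcan hexch ((hSm hs).inter hZ)
        Set.inter_subset_right, hker, ae_restrict_mem hZ.compl,
      hX.condExpKernel_ae_eq_reinf hcan hexch ((hSm hs).diff hZ) fun _ h => h.2] with x h1 h2 h3 h4
    -- Since Z ∈ σ(R), the conditional distribution at a point of Zᶜ does not charge Z.
    have h5 : condExpKernel ν (reinfSigma R) x (s ∩ nullPart R) = 0 := by
      rw [compl_compl, Set.indicator_of_notMem h3] at h2
      exact measure_mono_null Set.inter_subset_right h2
    rw [Measure.add_apply, Measure.smul_apply, Measure.restrict_apply (hSm hs), smul_eq_mul,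
      ← measure_inter_add_sdiff (μ := R x) s hZ, h1,
      ← measure_inter_add_sdiff (μ := condExpKernel ν (reinfSigma R) x) s hZ, h5, zero_add, h4, add_comm]
  filter_upwards [(ae_ball_iff hSc).2 h] with x hx
  exact ext_of_generate_finite S hSgen hSpi hx (hx _ hSu)

/-- The σ-algebra generated by the reinforcement kernel is a conditioning σ-algebra. -/
theorem isConditioningSigma_reinfSigma [StandardBorelSpace E] [IsFiniteMeasure ν] [IsFiniteMeasure μ]
    (hX : IsMVPS μ θ ν R X) (hcan : IsCanonical R) (hexch : Exchangeable μ X)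
    (hZ_pos : 0 < ν (nullPart R)) :
    IsConditioningSigma (reinfSigma R) ν R where
  le := hX.measurable_reinf.comap_le
  countablyGenerated := by
    have := hX.isProbabilityMeasure
    have := hX.finite_reinf
    have := MeasurableSpace.countablyGenerated_comap_measure R
    exact ⟨Set.univ, .univ, measure_univ, @MeasurableSpace.CountablyGenerated.comap _ _ (reinfSigma R) this _⟩
  measurableSet_compl :=
    (measurable_reinfSigma_apply R .univ (measurableSet_singleton 0)).compl
  representation := by
    have hZ := hX.measurableSet_nullPart
    rw [← ae_restrict_iff' hZ.compl]
    filter_upwards [hX.reinf_ae_eq hcan hexch, ae_restrict_mem hZ.compl] with x hx hxZ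
    -- Positivity of ν(Z) turns ν(Z) ν(· ∣ Z) into the restriction of ν to Z.
    rw [hcan x hxZ, inv_one, one_smul, ProbabilityTheory.cond, smul_smul,
      ENNReal.mul_inv_cancel hZ_pos.ne' (measure_ne_top _ _), one_smul]
    exact hx

end IsMVPS

theorem mainTheorem11 {Ω 𝕏 : Type*} [MeasurableSpace Ω] [MeasurableSpace 𝕏]
    [StandardBorelSpace 𝕏] (μ : Measure Ω) [IsProbabilityMeasure μ]
    (θ : ℝ) (ν : Measure 𝕏) [IsProbabilityMeasure ν] (R : 𝕏 → Measure 𝕏) (X : ℕ → Ω → 𝕏)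
    (hX : IsMVPS μ θ ν R X) (hexch : Exchangeable μ X) (hcan : IsCanonical R)
    (hZ_pos : 0 < ν (nullPart R)) (hZ_lt : ν (nullPart R) < 1) :
    (∃ G : MeasurableSpace 𝕏, IsConditioningSigma G ν R) ∧
    ∀ G : MeasurableSpace 𝕏, IsConditioningSigma G ν R →
      IsMVPS μ θ (atomLaw G ν) (atomReinforcement G ν (nullPart R))
        (fun n ω => atomMap G (X n ω)) ∧
      Exchangeable μ (fun n ω => atomMap G (X n ω)) :=
  ⟨⟨_, hX.isConditioningSigma_reinfSigma hcan hexch hZ_pos⟩, fun _ hG =>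
    ⟨hG.isMVPS_atomMap hX hexch hcan, hexch.comp (measurable_atomMap hG.le)⟩⟩
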